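/- There is an absolute constant $C>0$ such that the following holds. For every $k\in\mathbb{N}$, $\varepsilon\in(0,1]$ and $\delta\in(0,0.5]$ there is a randomized algorithm $M$ that, given the true answers $q_1(X),\dots,q_k(X)\in\mathbb{R}$ of $k$ queries on a dataset $X$, outputs random answers $(a_1,\dots,a_k)\in\mathbb{R}^k$, such that for every set $\mathcal{X}$ of datasets with a neighboring relation and all queries $q_1,\dots,q_k:\mathcal{X}\to\mathbb{R}$ of sensitivity at most one (that is, $|q_i(X)-q_i(X')|\le 1$ for all neighboring $X,X'$ and all $i$): (a) the algorithm $X\mapsto A(X):=M(q_1(X),\dots,q_k(X))$ is $(\varepsilon,\delta)$-differentially private, i.e. $\Pr[A(X)\in S]\le e^{\varepsilon}\Pr[A(X')\in S]+\delta$ for all neighboring datasets $X,X'$ and every measurable set $S\subseteq\mathbb{R}^k$; (b) for every dataset $X$ its expected $\ell_\infty$ error satisfies $$\mathbb{E}\Big[\max_{1\le i\le k}|q_i(X)-a_i|\Big]\le \frac{C}{\varepsilon}\sqrt{k\log\frac1\delta},\qquad (a_1,\dots,a_k)=A(X).$$ -/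

import Mathlib

open MeasureTheory ProbabilityTheory
open scoped ENNReal

namespace DP

/-- The sensitivity of a real-valued query `f` with respect to a neighboring relation:
the supremum of `|f X - f X'|` over all neighboring datasets `X, X'` (possibly infinite). -/
noncomputable def sensitivity {𝒳 : Type*} (nbr : 𝒳 → 𝒳 → Prop) (f : 𝒳 → ℝ) : ℝ≥0∞ :=
  ⨆ (X : 𝒳) (X' : 𝒳) (_ : nbr X X'), ENNReal.ofReal |f X - f X'|

/-- `(ε, δ)`-differential privacy of a randomized algorithm, given by the law `A X` of its output
on each dataset `X`. -/
def IsDifferentiallyPrivate {𝒳 Y : Type*} [MeasurableSpace Y] (nbr : 𝒳 → 𝒳 → Prop)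
    (ε δ : ℝ) (A : 𝒳 → Measure Y) : Prop :=
  ∀ X X' : 𝒳, nbr X X' → ∀ S : Set Y, MeasurableSet S →
    A X S ≤ ENNReal.ofReal (Real.exp ε) * A X' S + ENNReal.ofReal δ

/-- The `ℓ∞` error `max_i |v i - a i|` of the answers `a` when the true answers are `v`
(it is `0` when there are no queries). -/
noncomputable def linftyError {k : ℕ} (v a : Fin k → ℝ) : ℝ≥0∞ :=
  ⨆ i : Fin k, ENNReal.ofReal |v i - a i|

/-- The error bound `(1 / ε) * √(k * log (1 / δ))`. -/
noncomputable def errorBound (k : ℕ) (ε δ : ℝ) : ℝ :=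
  1 / ε * √((k : ℝ) * Real.log (1 / δ))

end DP

/-!
The mechanism adds to the vector of true answers a noise vector `R • u`, where
`R = 960 * √(k log (1/δ)) / ε` and `u` is drawn from one fixed density on `ℝᵏ` whose `ℓ∞` norm has
bounded mean. Write `L = log (1/δ)`, `s = √(k L)` and `l = min 1 (L / s)`. The density is
proportional to `∏ i, p (u i) * exp (-8 s (‖u‖ - 1)₊)`, with two ingredients.

* The profile `p u = (l + (1 - |u|)₊)² exp (-(|u| - 1)₊ / l)` falls quadratically from about `1` to
  `l²` on `[-1, 1]` and then exponentially at scale `l`. A shift by `w` changes `log p` at `u` by at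
  most `6 |w| / (l + (1 - |u|)₊)`. The square of this bound is integrable against `p` uniformly in
  `l`, and the bound itself never exceeds `6 |w| / l`. A Bernstein-type estimate therefore controls
  all exponential moments of the change up to order about `l / |w|`
  (`integral_profile_mul_exp_le`), while the mass of `p` outside `[-1, 1]` is only `2 l³`.
* The factor `exp (-8 s (‖u‖ - 1)₊)` is `8 s`-Lipschitz in logarithm for the `ℓ∞` norm, so under a
  shift of norm `1 / R` it costs at most `ε / 2` of privacy loss, deterministically. It
  keeps the mean `ℓ∞` norm bounded also when `l` is of constant order, where the maximum of `k`
  exponential tails of scale `l` would be of order `log k`.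

As the normalizing constant is at least the mass of the product on the cube `[-1, 1]ᵏ`
(`coreMass_pow_le`), passing from the product to the normalized density costs a factor of at most
`exp (O(l² k))`. For `L ≤ k` one has `l² k = L`, and a Chernoff bound with exponent `20 L / ε` leaves
a failure probability of at most `exp (-L) = δ`. For `k ≤ L` one has `l = 1`, and the privacy loss
is at most `ε` everywhere. In both cases `l² k ≤ s`, whence the bound on the mean norm
(`integral_norm_mul_noiseDensity_le`).
-/

namespace DP

/-! ### The one-dimensional profile -/

/-- The tent `(1 - |u|)₊` raised by `l`, so that it stays bounded away from `0`. -/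
noncomputable def taper (l u : ℝ) : ℝ := l + max (1 - |u|) 0

/-- The exponential tail of scale `l` outside `[-1, 1]`; it equals `1` on `[-1, 1]`. -/
noncomputable def decay (l u : ℝ) : ℝ := Real.exp (-(max (|u| - 1) 0) / l)

/-- The unnormalized one-dimensional noise density: the square of the taper, continued beyond
`[-1, 1]` by an exponential tail of scale `l`. -/
noncomputable def profile (l u : ℝ) : ℝ := taper l u ^ 2 * decay l u

/-- The privacy loss `log (p u / p (u + w))` of the profile `p` at the point `u` under the
shift `w`. -/
noncomputable def logRatio (l w u : ℝ) : ℝ := Real.log (profile l u) - Real.log (profile l (u + w))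

/-- The mass of the profile on `[-1, 1]`. -/
noncomputable def coreMass (l : ℝ) : ℝ := ∫ u in Set.Icc (-1 : ℝ) 1, profile l u

section Profile

variable {l : ℝ}

lemma le_taper (l u : ℝ) : l ≤ taper l u := by
  unfold taper
  linarith [le_max_right (1 - |u|) 0]

lemma taper_pos (hl : 0 < l) (u : ℝ) : 0 < taper l u := hl.trans_le (le_taper l u)

lemma taper_le (l u : ℝ) : taper l u ≤ l + 1 := by
  unfold taper
  have : max (1 - |u|) 0 ≤ 1 := max_le (by linarith [abs_nonneg u]) zero_le_one
  linarith

lemma decay_pos (l u : ℝ) : 0 < decay l u := Real.exp_pos _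

lemma profile_pos (hl : 0 < l) (u : ℝ) : 0 < profile l u :=
  mul_pos (pow_pos (taper_pos hl u) 2) (decay_pos l u)

@[fun_prop]
lemma continuous_taper (l : ℝ) : Continuous (taper l) := by
  unfold taper
  fun_prop

@[fun_prop]
lemma continuous_decay (l : ℝ) : Continuous (decay l) := by
  unfold decay
  fun_prop

@[fun_prop]
lemma continuous_profile (l : ℝ) : Continuous (profile l) := by
  unfold profile
  fun_prop

lemma continuous_logRatio (hl : 0 < l) (w : ℝ) : Continuous (logRatio l w) := by
  unfold logRatio
  exact ((continuous_profile l).log fun u => (profile_pos hl u).ne').sub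
    (((continuous_profile l).comp (by fun_prop)).log fun u => (profile_pos hl _).ne')

lemma log_profile (hl : 0 < l) (u : ℝ) :
    Real.log (profile l u) = 2 * Real.log (taper l u) - max (|u| - 1) 0 / l := by
  unfold profile decay
  rw [Real.log_mul (pow_pos (taper_pos hl u) 2).ne' (Real.exp_pos _).ne', Real.log_pow,
    Real.log_exp]
  push_cast
  ring

lemma profile_mul_exp_neg_logRatio (hl : 0 < l) (w u : ℝ) :
    profile l u * Real.exp (-logRatio l w u) = profile l (u + w) := by
  unfold logRatio
  rw [neg_sub, Real.exp_sub, Real.exp_log (profile_pos hl _), Real.exp_log (profile_pos hl _)]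
  field_simp [(profile_pos hl u).ne']

lemma abs_taper_sub_le (l w u : ℝ) : |taper l (u + w) - taper l u| ≤ |w| := by
  unfold taper
  have h1 : |max (1 - |u + w|) 0 - max (1 - |u|) 0| ≤ |(1 - |u + w|) - (1 - |u|)| :=
    abs_max_sub_max_le_abs _ _ _
  have h2 : |(1 - |u + w|) - (1 - |u|)| ≤ |w| := by
    have := abs_abs_sub_abs_le u (u + w)
    calc |(1 - |u + w|) - (1 - |u|)| = |(|u| - |u + w|)| := by ring_nf
      _ ≤ |u - (u + w)| := this
      _ = |w| := by rw [sub_add_cancel_left, abs_neg]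
  calc _ = |max (1 - |u + w|) 0 - max (1 - |u|) 0| := by ring_nf
    _ ≤ _ := h1.trans h2

lemma abs_log_taper_sub_le {w : ℝ} (hl : 0 < l) (hw : |w| ≤ l / 2) (u : ℝ) :
    |Real.log (taper l u) - Real.log (taper l (u + w))| ≤ 2 * |w| / taper l u := by
  have h := abs_le.1 (abs_taper_sub_le l w u)
  have h0 := taper_pos hl u
  have h1 := taper_pos hl (u + w)
  have h2 := le_taper l u
  have h3 : taper l u / 2 ≤ taper l (u + w) := by linarith
  rw [← Real.log_div h0.ne' h1.ne', abs_le]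
  constructor
  · have := Real.log_le_sub_one_of_pos (div_pos h1 h0)
    rw [← inv_div (taper l (u + w)), Real.log_inv]
    have h4 : taper l (u + w) / taper l u - 1 ≤ 2 * |w| / taper l u := by
      rw [div_sub_one h0.ne']
      gcongr
      linarith [abs_nonneg w]
    linarith
  · have := Real.log_le_sub_one_of_pos (div_pos h0 h1)
    have h4 : taper l u / taper l (u + w) - 1 ≤ 2 * |w| / taper l u := by
      rw [div_sub_one h1.ne', div_le_div_iff₀ h1 h0]
      nlinarith [abs_nonneg w]
    linarith

lemma abs_excess_sub_le {w : ℝ} (hl : 0 < l) (hw : |w| ≤ l / 2) (u : ℝ) :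
    |max (|u + w| - 1) 0 - max (|u| - 1) 0| / l ≤ 2 * |w| / taper l u := by
  have h1 : |max (|u + w| - 1) 0 - max (|u| - 1) 0| ≤ |w| := by
    refine (abs_max_sub_max_le_abs _ _ _).trans ?_
    calc |(|u + w| - 1) - (|u| - 1)| = |(|u + w| - |u|)| := by ring_nf
      _ ≤ |u + w - u| := abs_abs_sub_abs_le _ _
      _ = |w| := by rw [add_sub_cancel_left]
  have h0 := taper_pos hl u
  by_cases hu : 1 - |w| ≤ |u|
  · have h3 : taper l u ≤ 2 * l := by
      unfold taper
      have : max (1 - |u|) 0 ≤ l := max_le (by linarith) hl.le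
      linarith
    rw [div_le_div_iff₀ hl h0]
    nlinarith [abs_nonneg w, abs_nonneg (max (|u + w| - 1) 0 - max (|u| - 1) 0)]
  · push Not at hu
    rw [max_eq_right (by linarith [abs_add_le u w]), max_eq_right (by linarith [abs_nonneg w])]
    simp only [sub_self, abs_zero, zero_div]
    positivity

/-- The shift by `w` changes the logarithm of the profile by at most `6 |w|` over the taper. The
tail contributes to this only where the taper is at most `2 l`. -/
lemma abs_logRatio_le {w : ℝ} (hl : 0 < l) (hw : |w| ≤ l / 2) (u : ℝ) :
    |logRatio l w u| ≤ 6 * |w| / taper l u := by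
  have h1 := abs_le.1 (abs_log_taper_sub_le hl hw u)
  have h2 := abs_excess_sub_le hl hw u
  rw [← abs_of_pos hl, ← abs_div, abs_of_pos hl, sub_div] at h2
  have h2 := abs_le.1 h2
  have h3 : 6 * |w| / taper l u = 3 * (2 * |w| / taper l u) := by ring
  rw [logRatio, log_profile hl, log_profile hl, abs_le, h3]
  constructor <;> linarith [h1.1, h1.2, h2.1, h2.2]

lemma decay_eq_on_Ioi {u : ℝ} (hu : 1 < u) :
    decay l u = Real.exp (1 / l) * Real.exp (-l⁻¹ * u) := by
  unfold decay
  rw [abs_of_pos (by linarith), max_eq_left (by linarith), ← Real.exp_add]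
  congr 1
  ring

lemma decay_eq_one {u : ℝ} (hu : |u| ≤ 1) : decay l u = 1 := by
  unfold decay
  rw [max_eq_right (by linarith)]
  simp

lemma integrableOn_decay_Ioi_one (hl : 0 < l) : IntegrableOn (decay l) (Set.Ioi 1) := by
  refine IntegrableOn.congr_fun (f := fun u => Real.exp (1 / l) * Real.exp (-l⁻¹ * u)) ?_
    (fun u hu => (decay_eq_on_Ioi hu).symm) measurableSet_Ioi
  exact (integrableOn_exp_mul_Ioi (by simpa using hl) 1).const_mul _

lemma integral_decay_Ioi_one (hl : 0 < l) : ∫ u in Set.Ioi 1, decay l u = l := by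
  rw [setIntegral_congr_fun measurableSet_Ioi (fun u hu => decay_eq_on_Ioi (l := l) hu),
    integral_const_mul, integral_exp_mul_Ioi (by simpa using hl)]
  rw [mul_div_assoc', mul_neg, ← Real.exp_add]
  simp

lemma integrable_decay (hl : 0 < l) : Integrable (decay l) := by
  have h0 : IntegrableOn (decay l) (Set.Ioi 0) := by
    rw [← Set.Ioc_union_Ioi_eq_Ioi zero_le_one]
    refine IntegrableOn.union ?_ (integrableOn_decay_Ioi_one hl)
    exact ((continuous_decay l).integrableOn_Icc).mono_set Set.Ioc_subset_Icc_self
  have h : IntegrableOn (decay l) (Set.Iic 0) := by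
    have h1 : IntegrableOn (fun u => decay l (-u)) (Set.Iic 0) :=
      ((integrableOn_Ici_iff_integrableOn_Ioi (μ := volume)).2 (by simpa using h0)).comp_neg_Iic
    have h2 : (fun u => decay l (-u)) = decay l := by
      ext u
      simp [decay]
    rwa [h2] at h1
  rw [← integrableOn_univ, ← Set.Iic_union_Ioi (a := (0 : ℝ))]
  exact h.union h0

lemma integral_decay (hl : 0 < l) : ∫ u, decay l u = 2 + 2 * l := by
  have h : ∀ u, decay l |u| = decay l u := fun u => by simp [decay]
  have h1 : ∫ u in Set.Ioc (0 : ℝ) 1, decay l u = 1 := by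
    rw [setIntegral_congr_fun (g := fun _ => (1 : ℝ)) measurableSet_Ioc
      (fun u hu => decay_eq_one (by rw [abs_of_pos hu.1]; exact hu.2))]
    simp
  rw [← integral_congr_ae (Filter.Eventually.of_forall h), integral_comp_abs,
    ← Set.Ioc_union_Ioi_eq_Ioi (zero_le_one (α := ℝ)),
    setIntegral_union (Set.Ioc_disjoint_Ioi le_rfl) measurableSet_Ioi
      ((integrable_decay hl).integrableOn) ((integrable_decay hl).integrableOn),
    integral_decay_Ioi_one hl, h1]
  ring

lemma integrable_profile (hl : 0 < l) : Integrable (profile l) := by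
  refine ((integrable_decay hl).const_mul ((l + 1) ^ 2)).mono'
    (continuous_profile l).aestronglyMeasurable (Filter.Eventually.of_forall fun u => ?_)
  rw [Real.norm_of_nonneg (profile_pos hl u).le, profile]
  have := taper_le l u
  have := taper_pos hl u
  have := decay_pos l u
  gcongr

lemma integral_profile (hl : 0 < l) : ∫ u, profile l u = coreMass l + 2 * l ^ 3 := by
  -- Outside `[-1, 1]` the profile is `l ^ 2 * decay`, and `decay = 1` inside.
  have h : ∀ u, profile l u = (Set.Icc (-1 : ℝ) 1).indicator (profile l) u
      + l ^ 2 * (decay l u - (Set.Icc (-1 : ℝ) 1).indicator (fun _ => (1 : ℝ)) u) := by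
    intro u
    by_cases hu : u ∈ Set.Icc (-1 : ℝ) 1
    · simp [hu, decay_eq_one (abs_le.2 hu)]
    · simp only [Set.indicator_of_notMem hu, profile, taper]
      have : 1 < |u| := by
        by_contra hc
        exact hu (abs_le.1 (not_lt.1 hc))
      rw [max_eq_right (by linarith)]
      ring
  have h1 : Integrable ((Set.Icc (-1 : ℝ) 1).indicator (fun _ => (1 : ℝ))) := by
    rw [integrable_indicator_iff measurableSet_Icc]
    exact continuous_const.integrableOn_Icc
  have h2 : Integrable fun u => decay l u - (Set.Icc (-1 : ℝ) 1).indicator (fun _ => (1 : ℝ)) u :=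
    (integrable_decay hl).sub h1
  rw [integral_congr_ae (Filter.Eventually.of_forall h),
    integral_add ((integrable_profile hl).indicator measurableSet_Icc) (h2.const_mul _),
    integral_const_mul, integral_sub (integrable_decay hl) h1, integral_indicator measurableSet_Icc,
    integral_indicator measurableSet_Icc, integral_decay hl, coreMass]
  simp
  ring

lemma coreMass_ge (hl : 0 < l) : 1 / 4 ≤ coreMass l := by
  -- On `[-1/2, 1/2]` the taper is at least `1 / 2`.
  have h : ∫ _ in Set.Icc (-(1 / 2) : ℝ) (1 / 2), (1 / 4 : ℝ)
      ≤ ∫ u in Set.Icc (-(1 / 2) : ℝ) (1 / 2), profile l u := by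
    refine setIntegral_mono_on continuous_const.integrableOn_Icc
      (integrable_profile hl).integrableOn measurableSet_Icc fun u hu => ?_
    have hu : |u| ≤ 1 / 2 := abs_le.2 hu
    rw [profile, decay_eq_one (by linarith)]
    have : 1 / 2 ≤ taper l u := by
      unfold taper
      linarith [le_max_left (1 - |u|) 0]
    nlinarith
  have h2 : ∫ u in Set.Icc (-(1 / 2) : ℝ) (1 / 2), profile l u ≤ coreMass l :=
    setIntegral_mono_set (integrable_profile hl).integrableOn
      (Filter.Eventually.of_forall fun u => (profile_pos hl u).le)
      (Set.Icc_subset_Icc (by norm_num) (by norm_num)).eventuallyLE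
  refine le_trans ?_ (h.trans h2)
  simp
  norm_num

lemma abs_mul_logRatio_le_one {a w : ℝ} (hl : 0 < l) (ha : 1 ≤ a) (hw : a * |w| ≤ l / 48)
    (u : ℝ) : |a * logRatio l w u| ≤ 1 := by
  have hw' : |w| ≤ l / 2 := by nlinarith [abs_nonneg w]
  have h := abs_logRatio_le hl hw' u
  rw [abs_mul, abs_of_pos (by linarith : (0 : ℝ) < a)]
  calc a * |logRatio l w u| ≤ a * (6 * |w| / l) := by
        refine mul_le_mul_of_nonneg_left (h.trans ?_) (by linarith)
        have := le_taper l u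
        gcongr
    _ ≤ 1 := by
        rw [mul_div_assoc', div_le_one hl]
        linarith

lemma integrable_profile_mul_exp {a w : ℝ} (hl : 0 < l) (ha : 1 ≤ a) (hw : a * |w| ≤ l / 48) :
    Integrable fun u => profile l u * Real.exp (a * logRatio l w u) := by
  refine ((integrable_profile hl).mul_const (Real.exp 1)).mono'
    ((continuous_profile l).mul
      (Real.continuous_exp.comp ((continuous_logRatio hl w).const_mul a))).aestronglyMeasurable
    (Filter.Eventually.of_forall fun u => ?_)
  have := profile_pos hl u
  rw [Real.norm_of_nonneg (by positivity)]
  gcongr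
  exact (abs_le.1 (abs_mul_logRatio_le_one hl ha hw u)).2

/-- The squared taper in the profile cancels the denominator of the squared privacy loss; this is
why the profile falls quadratically. -/
lemma profile_mul_logRatio_sq_le {w : ℝ} (hl : 0 < l) (hw : |w| ≤ l / 2) (u : ℝ) :
    profile l u * logRatio l w u ^ 2 ≤ 36 * w ^ 2 * decay l u := by
  have h0 := taper_pos hl u
  have h := pow_le_pow_left₀ (abs_nonneg _) (abs_logRatio_le hl hw u) 2
  rw [sq_abs, div_pow, mul_pow, sq_abs] at h
  calc profile l u * logRatio l w u ^ 2
      ≤ taper l u ^ 2 * decay l u * (6 ^ 2 * w ^ 2 / taper l u ^ 2) :=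
        mul_le_mul_of_nonneg_left h (profile_pos hl u).le
    _ = 36 * w ^ 2 * decay l u := by
        field_simp
        ring

lemma integrable_profile_mul_logRatio_sq {w : ℝ} (hl : 0 < l) (hw : |w| ≤ l / 2) :
    Integrable fun u => profile l u * logRatio l w u ^ 2 := by
  refine ((integrable_decay hl).const_mul (36 * w ^ 2)).mono'
    ((continuous_profile l).mul ((continuous_logRatio hl w).pow 2)).aestronglyMeasurable
    (Filter.Eventually.of_forall fun u => ?_)
  have := profile_pos hl u
  rw [Real.norm_of_nonneg (by positivity)]
  exact profile_mul_logRatio_sq_le hl hw u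

lemma integrable_profile_mul_logRatio {w : ℝ} (hl : 0 < l) (hw : |w| ≤ l / 48) :
    Integrable fun u => profile l u * logRatio l w u := by
  refine (integrable_profile hl).mono'
    ((continuous_profile l).mul (continuous_logRatio hl w)).aestronglyMeasurable
    (Filter.Eventually.of_forall fun u => ?_)
  have h := abs_mul_logRatio_le_one hl le_rfl (by rwa [one_mul]) u
  rw [one_mul] at h
  rw [norm_mul, Real.norm_of_nonneg (profile_pos hl u).le, Real.norm_eq_abs]
  exact mul_le_of_le_one_right (profile_pos hl u).le h

lemma integral_profile_mul_logRatio_sq_le {w : ℝ} (hl : 0 < l) (hl1 : l ≤ 1) (hw : |w| ≤ l / 2) :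
    ∫ u, profile l u * logRatio l w u ^ 2 ≤ 144 * w ^ 2 := by
  calc ∫ u, profile l u * logRatio l w u ^ 2 ≤ ∫ u, 36 * w ^ 2 * decay l u :=
        integral_mono (integrable_profile_mul_logRatio_sq hl hw)
          ((integrable_decay hl).const_mul _) (profile_mul_logRatio_sq_le hl hw)
    _ = 36 * w ^ 2 * (2 + 2 * l) := by rw [integral_const_mul, integral_decay hl]
    _ ≤ 144 * w ^ 2 := by nlinarith [sq_nonneg w]

/-- The mean privacy loss is of second order in the shift, because `∫ p * exp (-g) = ∫ p` for the
privacy loss `g` by translation invariance. -/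
lemma integral_profile_mul_logRatio_le {w : ℝ} (hl : 0 < l) (hw : |w| ≤ l / 48) :
    ∫ u, profile l u * logRatio l w u ≤ ∫ u, profile l u * logRatio l w u ^ 2 := by
  have hw2 : |w| ≤ l / 2 := by linarith
  have i0 := integrable_profile hl
  have i1 := integrable_profile_mul_logRatio hl hw
  have i2 := integrable_profile_mul_logRatio_sq hl hw2
  have h : ∫ u, profile l u ≤ ∫ u, (profile l u - profile l u * logRatio l w u
      + profile l u * logRatio l w u ^ 2) := by
    rw [← integral_add_right_eq_self (profile l) w]
    refine integral_mono (i0.comp_add_right w) ((i0.sub i1).add i2) fun u => ?_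
    have h1 := abs_mul_logRatio_le_one hl le_rfl (by rwa [one_mul]) u
    rw [one_mul, ← abs_neg] at h1
    have h2 := (abs_le.1 (Real.abs_exp_sub_one_sub_id_le h1)).2
    rw [neg_sq] at h2
    have h3 := mul_le_mul_of_nonneg_left h2 (profile_pos hl u).le
    simp only
    rw [← profile_mul_exp_neg_logRatio hl w u]
    linarith
  have i01 : Integrable fun u => profile l u - profile l u * logRatio l w u := i0.sub i1
  rw [integral_add i01 i2, integral_sub i0 i1] at h
  linarith

/-- The exponential moment of the privacy loss, measured against the mass on `[-1, 1]` only: the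
relative excess `9 * l ^ 2` covers both the mass outside `[-1, 1]` and the quadratic term of the
exponential. -/
lemma integral_profile_mul_exp_le {a w : ℝ} (hl : 0 < l) (hl1 : l ≤ 1) (ha : 1 ≤ a)
    (hw : a * |w| ≤ l / 48) :
    ∫ u, profile l u * Real.exp (a * logRatio l w u) ≤ coreMass l * (1 + 9 * l ^ 2) := by
  have hw1 : |w| ≤ l / 48 := by nlinarith [abs_nonneg w]
  have hw2 : |w| ≤ l / 2 := by linarith
  have i0 := integrable_profile hl
  have i1 := (integrable_profile_mul_logRatio hl hw1).const_mul a
  have i2 := (integrable_profile_mul_logRatio_sq hl hw2).const_mul (a ^ 2)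
  have h1 : ∫ u, profile l u * Real.exp (a * logRatio l w u)
      ≤ ∫ u, (profile l u + a * (profile l u * logRatio l w u)
        + a ^ 2 * (profile l u * logRatio l w u ^ 2)) := by
    refine integral_mono (integrable_profile_mul_exp hl ha hw) ((i0.add i1).add i2) fun u => ?_
    have h2 := (abs_le.1 (Real.abs_exp_sub_one_sub_id_le
      (abs_mul_logRatio_le_one hl ha hw u))).2
    have h3 := mul_le_mul_of_nonneg_left h2 (profile_pos hl u).le
    simp only
    linarith
  have i01 : Integrable fun u => profile l u + a * (profile l u * logRatio l w u) := i0.add i1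
  rw [integral_add i01 i2, integral_add i0 i1, integral_const_mul, integral_const_mul,
    integral_profile hl] at h1
  have h3 := integral_profile_mul_logRatio_le hl hw1
  have h4 := integral_profile_mul_logRatio_sq_le hl hl1 hw2
  have h5 : (a * |w|) ^ 2 ≤ (l / 48) ^ 2 := pow_le_pow_left₀ (by positivity) hw 2
  rw [mul_pow, sq_abs] at h5
  have h6 : 0 ≤ ∫ u, profile l u * logRatio l w u ^ 2 :=
    integral_nonneg fun u => mul_nonneg (profile_pos hl u).le (sq_nonneg _)
  have h7 := coreMass_ge hl
  refine h1.trans ?_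
  have h8 : a * ∫ u, profile l u * logRatio l w u ≤ a ^ 2 * (144 * w ^ 2) := by
    have := mul_le_mul_of_nonneg_left (h3.trans h4) (by linarith : 0 ≤ a)
    nlinarith [mul_nonneg (by nlinarith : 0 ≤ a ^ 2 - a) (sq_nonneg w)]
  have h9 := mul_le_mul_of_nonneg_left h4 (sq_nonneg a)
  have h10 : l ^ 3 ≤ l ^ 2 := pow_le_pow_of_le_one hl.le hl1 (by norm_num)
  nlinarith [sq_nonneg l]

end Profile

/-! ### The noise density on `ℝᵏ` -/

/-- The unnormalized noise density: a product of profiles, damped at rate `m` in the distance of the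
sup norm (`‖u‖` on `Fin k → ℝ`) beyond `1`. -/
noncomputable def noiseDensity {k : ℕ} (l m : ℝ) (u : Fin k → ℝ) : ℝ :=
  (∏ i, profile l (u i)) * Real.exp (-(m * max (‖u‖ - 1) 0))

section NoiseDensity

variable {k : ℕ} {l m : ℝ}

lemma noiseDensity_pos (hl : 0 < l) (u : Fin k → ℝ) : 0 < noiseDensity l m u :=
  mul_pos (Finset.prod_pos fun i _ => profile_pos hl (u i)) (Real.exp_pos _)

@[fun_prop]
lemma continuous_noiseDensity (l m : ℝ) :
    Continuous (noiseDensity l m : (Fin k → ℝ) → ℝ) := by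
  unfold noiseDensity
  fun_prop

lemma integrable_prod_profile (hl : 0 < l) :
    Integrable fun u : Fin k → ℝ => ∏ i, profile l (u i) :=
  Integrable.fintype_prod fun _ => integrable_profile hl

lemma noiseDensity_le_prod (hl : 0 < l) (hm : 0 ≤ m) (u : Fin k → ℝ) :
    noiseDensity l m u ≤ ∏ i, profile l (u i) := by
  refine mul_le_of_le_one_right (Finset.prod_nonneg fun i _ => (profile_pos hl (u i)).le) ?_
  rw [Real.exp_le_one_iff, neg_nonpos]
  positivity

lemma integrable_noiseDensity (hl : 0 < l) (hm : 0 ≤ m) :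
    Integrable (noiseDensity l m : (Fin k → ℝ) → ℝ) := by
  refine (integrable_prod_profile hl).mono' (continuous_noiseDensity l m).aestronglyMeasurable
    (Filter.Eventually.of_forall fun u => ?_)
  rw [Real.norm_of_nonneg (noiseDensity_pos hl u).le]
  exact noiseDensity_le_prod hl hm u

/-- The damping factor is `1` on the cube `[-1, 1]ᵏ`, so the total mass is at least that of the
product on the cube. -/
lemma coreMass_pow_le (hl : 0 < l) (hm : 0 ≤ m) :
    coreMass l ^ k ≤ ∫ u : Fin k → ℝ, noiseDensity l m u := by
  have h : coreMass l ^ k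
      = ∫ u : Fin k → ℝ, ∏ i, (Set.Icc (-1 : ℝ) 1).indicator (profile l) (u i) := by
    rw [integral_fintype_prod_volume_eq_pow, integral_indicator measurableSet_Icc, coreMass,
      Fintype.card_fin]
  rw [h]
  refine integral_mono (Integrable.fintype_prod fun _ =>
    (integrable_profile hl).indicator measurableSet_Icc) (integrable_noiseDensity hl hm) fun u => ?_
  by_cases hu : ∀ i, u i ∈ Set.Icc (-1 : ℝ) 1
  · have h1 : ‖u‖ ≤ 1 := (pi_norm_le_iff_of_nonneg zero_le_one).2 fun i => abs_le.2 (hu i)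
    refine le_of_eq ?_
    simp only [noiseDensity]
    rw [max_eq_right (by linarith), mul_zero, neg_zero, Real.exp_zero, mul_one]
    exact Finset.prod_congr rfl fun i _ => Set.indicator_of_mem (hu i) _
  · push Not at hu
    obtain ⟨i, hi⟩ := hu
    simp only
    rw [Finset.prod_eq_zero (Finset.mem_univ i) (Set.indicator_of_notMem hi _)]
    exact (noiseDensity_pos hl u).le

lemma integral_noiseDensity_pos (hl : 0 < l) (hm : 0 ≤ m) :
    0 < ∫ u : Fin k → ℝ, noiseDensity l m u :=
  (pow_pos (by linarith [coreMass_ge hl]) k).trans_le (coreMass_pow_le hl hm)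

lemma integral_prod_profile_le (hl : 0 < l) (hl1 : l ≤ 1) :
    ∫ u : Fin k → ℝ, ∏ i, profile l (u i) ≤ coreMass l ^ k * Real.exp (8 * l ^ 2 * k) := by
  have h0 := coreMass_ge hl
  have h1 : ∫ u, profile l u ≤ coreMass l * Real.exp (8 * l ^ 2) := by
    rw [integral_profile hl]
    have h10 : l ^ 3 ≤ l ^ 2 := pow_le_pow_of_le_one hl.le hl1 (by norm_num)
    have h2 := Real.add_one_le_exp (8 * l ^ 2)
    nlinarith
  rw [integral_fintype_prod_volume_eq_pow, Fintype.card_fin]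
  refine (pow_le_pow_left₀ (integral_nonneg fun u => (profile_pos hl u).le) h1 k).trans_eq ?_
  rw [mul_pow, ← Real.exp_nat_mul]
  ring_nf

lemma mul_exp_neg_le {y : ℝ} (hm : 0 < m) :
    y * Real.exp (-(m * y)) ≤ Real.exp (-(m * y)) + Real.exp (-m) / m := by
  -- Shift by `1`: `t * exp (-t) ≤ 1` at `t = m * (y - 1)`.
  have h1 : (m * (y - 1)) * Real.exp (-(m * (y - 1))) ≤ 1 := by
    rw [Real.exp_neg, ← div_eq_mul_inv, div_le_one (Real.exp_pos _)]
    linarith [Real.add_one_le_exp (m * (y - 1))]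
  have h2 : (y - 1) * Real.exp (-(m * y))
      = (m * (y - 1)) * Real.exp (-(m * (y - 1))) * (Real.exp (-m) / m) := by
    have : Real.exp (-(m * y)) = Real.exp (-(m * (y - 1))) * Real.exp (-m) := by
      rw [← Real.exp_add]
      ring_nf
    rw [this]
    field_simp
  have h3 := mul_le_mul_of_nonneg_right h1 (by positivity : 0 ≤ Real.exp (-m) / m)
  linarith

lemma norm_mul_noiseDensity_le (hl : 0 < l) (hm : 0 < m) (u : Fin k → ℝ) :
    ‖u‖ * noiseDensity l m u
      ≤ 2 * noiseDensity l m u + Real.exp (-m) / m * ∏ i, profile l (u i) := by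
  set P := ∏ i, profile l (u i) with hP
  have hP0 : 0 ≤ P := Finset.prod_nonneg fun i _ => (profile_pos hl (u i)).le
  have h1 := mul_exp_neg_le (y := max (‖u‖ - 1) 0) hm
  have h2 : ‖u‖ ≤ 1 + max (‖u‖ - 1) 0 := by linarith [le_max_left (‖u‖ - 1) 0]
  have h3 := mul_le_mul_of_nonneg_left h1 hP0
  have h4 := mul_le_mul_of_nonneg_right h2 (noiseDensity_pos (m := m) hl u).le
  refine h4.trans ?_
  unfold noiseDensity
  rw [← hP]
  linarith

lemma integrable_norm_mul_noiseDensity (hl : 0 < l) (hm : 0 < m) :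
    Integrable fun u : Fin k → ℝ => ‖u‖ * noiseDensity l m u := by
  refine (((integrable_noiseDensity hl hm.le).const_mul 2).add
    ((integrable_prod_profile hl).const_mul (Real.exp (-m) / m))).mono'
    (continuous_norm.mul (continuous_noiseDensity l m)).aestronglyMeasurable
    (Filter.Eventually.of_forall fun u => ?_)
  rw [Real.norm_of_nonneg (mul_nonneg (norm_nonneg _) (noiseDensity_pos hl u).le)]
  exact norm_mul_noiseDensity_le hl hm u

lemma integral_norm_mul_noiseDensity_le (hl : 0 < l) (hl1 : l ≤ 1) (hm : 1 ≤ m)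
    (hk : 8 * l ^ 2 * k ≤ m) :
    ∫ u : Fin k → ℝ, ‖u‖ * noiseDensity l m u ≤ 3 * ∫ u : Fin k → ℝ, noiseDensity l m u := by
  have hm0 : 0 < m := by linarith
  have i1 := (integrable_noiseDensity (k := k) hl hm0.le).const_mul 2
  have i2 := (integrable_prod_profile (k := k) hl).const_mul (Real.exp (-m) / m)
  have h := integral_mono (integrable_norm_mul_noiseDensity hl hm0) (i1.add i2)
    (norm_mul_noiseDensity_le (k := k) hl hm0)
  simp only [Pi.add_apply] at h
  rw [integral_add i1 i2, integral_const_mul, integral_const_mul] at h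
  have hc : 0 ≤ coreMass l ^ k := pow_nonneg (by linarith [coreMass_ge hl]) k
  have h2 : Real.exp (-m) / m * ∫ u : Fin k → ℝ, ∏ i, profile l (u i) ≤ coreMass l ^ k := by
    calc Real.exp (-m) / m * ∫ u : Fin k → ℝ, ∏ i, profile l (u i)
        ≤ Real.exp (-m) * (coreMass l ^ k * Real.exp m) := by
          gcongr
          · exact integral_nonneg fun u => Finset.prod_nonneg fun i _ => (profile_pos hl (u i)).le
          · exact div_le_self (Real.exp_pos _).le hm
          · refine (integral_prod_profile_le hl hl1).trans ?_
            gcongr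
      _ = coreMass l ^ k := by
          rw [mul_left_comm, ← Real.exp_add]
          simp
  have h3 := coreMass_pow_le (k := k) hl hm0.le
  linarith

lemma noiseDensity_eq_exp_mul (hl : 0 < l) (w u : Fin k → ℝ) :
    noiseDensity l m u = Real.exp (∑ i, logRatio l (w i) (u i)
      + m * (max (‖u + w‖ - 1) 0 - max (‖u‖ - 1) 0)) * noiseDensity l m (u + w) := by
  have h : ∀ i, profile l (u i) = Real.exp (logRatio l (w i) (u i)) * profile l ((u + w) i) := by
    intro i
    rw [Pi.add_apply, ← profile_mul_exp_neg_logRatio hl (w i) (u i), mul_left_comm, ← Real.exp_add]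
    simp
  unfold noiseDensity
  rw [Finset.prod_congr rfl fun i _ => h i, Finset.prod_mul_distrib, ← Real.exp_sum, mul_assoc,
    mul_left_comm, ← Real.exp_add, mul_left_comm, ← Real.exp_add]
  ring_nf

/-- The damping factor takes half of the privacy budget and the product part the other half. -/
lemma noiseDensity_le_of_sum_le {ε : ℝ} {w u : Fin k → ℝ} (hl : 0 < l) (hm : 0 ≤ m)
    (hw : m * ‖w‖ ≤ ε / 2) (h : ∑ i, logRatio l (w i) (u i) ≤ ε / 2) :
    noiseDensity l m u ≤ Real.exp ε * noiseDensity l m (u + w) := by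
  rw [noiseDensity_eq_exp_mul hl w u]
  refine mul_le_mul_of_nonneg_right (Real.exp_le_exp.2 ?_) (noiseDensity_pos hl _).le
  have h1 : max (‖u + w‖ - 1) 0 - max (‖u‖ - 1) 0 ≤ ‖w‖ := by
    rw [sub_le_iff_le_add]
    refine max_le ?_ (by positivity)
    linarith [norm_add_le u w, le_max_left (‖u‖ - 1) 0]
  have h2 := mul_le_mul_of_nonneg_left h1 hm
  linarith

/-- The Chernoff majorant of the noise density on the event that the product part loses more than
`ε / 2`: the product of the profiles times `exp (a * (∑ i, g i - ε / 2))`, where `g i` is the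
privacy loss of coordinate `i`. -/
noncomputable def lossExcess (l ε a : ℝ) (w u : Fin k → ℝ) : ℝ :=
  Real.exp (-(a * (ε / 2))) * ∏ i, (profile l (u i) * Real.exp (a * logRatio l (w i) (u i)))

lemma lossExcess_nonneg {ε a : ℝ} (hl : 0 < l) (w u : Fin k → ℝ) : 0 ≤ lossExcess l ε a w u :=
  mul_nonneg (Real.exp_pos _).le (Finset.prod_nonneg fun i _ =>
    mul_nonneg (profile_pos hl (u i)).le (Real.exp_pos _).le)

lemma noiseDensity_le_add_lossExcess {ε a : ℝ} {w : Fin k → ℝ} (hl : 0 < l) (hm : 0 ≤ m)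
    (ha : 0 ≤ a) (hw : m * ‖w‖ ≤ ε / 2) (u : Fin k → ℝ) :
    noiseDensity l m u ≤ Real.exp ε * noiseDensity l m (u + w) + lossExcess l ε a w u := by
  by_cases h : ∑ i, logRatio l (w i) (u i) ≤ ε / 2
  · linarith [noiseDensity_le_of_sum_le hl hm hw h, lossExcess_nonneg (ε := ε) (a := a) hl w u]
  · push Not at h
    have h1 : ∏ i, profile l (u i) ≤ lossExcess l ε a w u := by
      unfold lossExcess
      rw [Finset.prod_mul_distrib, ← Real.exp_sum, mul_left_comm, ← Real.exp_add,
        ← Finset.mul_sum]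
      refine le_mul_of_one_le_right (Finset.prod_nonneg fun i _ => (profile_pos hl (u i)).le) ?_
      rw [Real.one_le_exp_iff]
      nlinarith
    have := mul_pos (Real.exp_pos ε) (noiseDensity_pos (m := m) hl (u + w))
    linarith [noiseDensity_le_prod hl hm u]

lemma integrable_lossExcess {ε a : ℝ} {w : Fin k → ℝ} (hl : 0 < l) (ha : 1 ≤ a)
    (hw : a * ‖w‖ ≤ l / 48) : Integrable (lossExcess l ε a w) := by
  refine Integrable.const_mul (Integrable.fintype_prod
    (f := fun i u => profile l u * Real.exp (a * logRatio l (w i) u)) fun i => ?_) _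
  exact integrable_profile_mul_exp hl ha
    ((mul_le_mul_of_nonneg_left (norm_le_pi_norm w i) (by linarith)).trans hw)

lemma integral_lossExcess_le {ε a : ℝ} {w : Fin k → ℝ} (hl : 0 < l) (hl1 : l ≤ 1) (ha : 1 ≤ a)
    (hw : a * ‖w‖ ≤ l / 48) :
    ∫ u, lossExcess l ε a w u ≤ Real.exp (9 * l ^ 2 * k - a * (ε / 2)) * coreMass l ^ k := by
  unfold lossExcess
  rw [integral_const_mul, integral_fintype_prod_volume_eq_prod
    (f := fun i u => profile l u * Real.exp (a * logRatio l (w i) u))]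
  have h0 := coreMass_ge hl
  have h : ∀ i, ∫ u, profile l u * Real.exp (a * logRatio l (w i) u)
      ≤ coreMass l * Real.exp (9 * l ^ 2) := by
    intro i
    refine (integral_profile_mul_exp_le hl hl1 ha
      ((mul_le_mul_of_nonneg_left (norm_le_pi_norm w i) (by linarith)).trans hw)).trans ?_
    have := Real.add_one_le_exp (9 * l ^ 2)
    gcongr
    linarith
  calc _ ≤ Real.exp (-(a * (ε / 2))) * ∏ _i : Fin k, (coreMass l * Real.exp (9 * l ^ 2)) := by
        gcongr with i
        · exact fun i _ => integral_nonneg fun u =>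
            mul_nonneg (profile_pos hl u).le (Real.exp_pos _).le
        · exact h i
    _ = _ := by
        rw [Finset.prod_const, Finset.card_univ, Fintype.card_fin, mul_pow, ← Real.exp_nat_mul,
          mul_left_comm, ← Real.exp_add, mul_comm]
        ring_nf

/-- The worst-case privacy loss of the product part; it suffices when `l = 1`. -/
lemma sum_logRatio_le {w : Fin k → ℝ} (hl : 0 < l) (hw : ‖w‖ ≤ l / 2) (u : Fin k → ℝ) :
    ∑ i, logRatio l (w i) (u i) ≤ k * (6 * ‖w‖ / l) := by
  calc ∑ i, logRatio l (w i) (u i) ≤ ∑ _i : Fin k, 6 * ‖w‖ / l := by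
        refine Finset.sum_le_sum fun i _ => ?_
        have hi : |w i| ≤ ‖w‖ := norm_le_pi_norm w i
        refine (le_abs_self _).trans ((abs_logRatio_le hl (hi.trans hw) (u i)).trans ?_)
        have := le_taper l (u i)
        gcongr
    _ = k * (6 * ‖w‖ / l) := by simp

end NoiseDensity

/-! ### The noise distribution and the additive mechanism -/

/-- The probability measure on `ℝᵏ` with density proportional to `noiseDensity l m`. -/
noncomputable def noiseMeasure (k : ℕ) (l m : ℝ) : Measure (Fin k → ℝ) :=
  volume.withDensity fun u =>
    ENNReal.ofReal (noiseDensity l m u / ∫ v : Fin k → ℝ, noiseDensity l m v)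

section NoiseMeasure

variable {k : ℕ} {l m : ℝ}

lemma isProbabilityMeasure_noiseMeasure (hl : 0 < l) (hm : 0 ≤ m) :
    IsProbabilityMeasure (noiseMeasure k l m) := by
  have hZ := integral_noiseDensity_pos (k := k) hl hm
  constructor
  rw [noiseMeasure, withDensity_apply _ MeasurableSet.univ, Measure.restrict_univ,
    ← ofReal_integral_eq_lintegral_ofReal ((integrable_noiseDensity hl hm).div_const _)
      (Filter.Eventually.of_forall fun u => (div_pos (noiseDensity_pos hl u) hZ).le),
    integral_div, div_self hZ.ne', ENNReal.ofReal_one]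

/-- A pointwise comparison of the density with its translate, up to an error `G` of small integral,
gives approximate indistinguishability of the measure from its translate. -/
lemma noiseMeasure_le_of_forall_le {ε δ : ℝ} {w : Fin k → ℝ} {G : (Fin k → ℝ) → ℝ} (hl : 0 < l)
    (hm : 0 ≤ m) (hG : Integrable G) (hG0 : ∀ u, 0 ≤ G u)
    (hGd : ∫ u, G u ≤ δ * ∫ u : Fin k → ℝ, noiseDensity l m u)
    (h : ∀ u, noiseDensity l m u ≤ Real.exp ε * noiseDensity l m (u + w) + G u)
    {S : Set (Fin k → ℝ)} (hS : MeasurableSet S) :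
    noiseMeasure k l m S ≤ ENNReal.ofReal (Real.exp ε) *
      noiseMeasure k l m ((fun u => u - w) ⁻¹' S) + ENNReal.ofReal δ := by
  have hZ := integral_noiseDensity_pos (k := k) hl hm
  have hS' : MeasurableSet ((fun u => u - w) ⁻¹' S) := (measurable_id.sub_const w) hS
  rw [noiseMeasure, withDensity_apply _ hS, withDensity_apply _ hS']
  set Z := ∫ u : Fin k → ℝ, noiseDensity l m u
  have hmeas : Measurable fun u : Fin k → ℝ => ENNReal.ofReal (noiseDensity l m u / Z) :=
    ((continuous_noiseDensity l m).measurable.div_const Z).ennreal_ofReal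
  have hshift : ∫⁻ u in (fun u => u - w) ⁻¹' S, ENNReal.ofReal (noiseDensity l m u / Z)
      = ∫⁻ u in S, ENNReal.ofReal (noiseDensity l m (u + w) / Z) := by
    rw [← lintegral_indicator hS', ← lintegral_indicator hS, ← lintegral_add_right_eq_self _ w]
    refine lintegral_congr fun u => ?_
    have hu : u + w ∈ (fun u => u - w) ⁻¹' S ↔ u ∈ S := by
      change u + w - w ∈ S ↔ u ∈ S
      rw [add_sub_cancel_right]
    by_cases huS : u ∈ S
    · rw [Set.indicator_of_mem (hu.2 huS), Set.indicator_of_mem huS]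
    · rw [Set.indicator_of_notMem (mt hu.1 huS), Set.indicator_of_notMem huS]
  have hGint : ∫⁻ u in S, ENNReal.ofReal (G u / Z) ≤ ENNReal.ofReal δ := by
    refine (setLIntegral_le_lintegral S _).trans ?_
    rw [← ofReal_integral_eq_lintegral_ofReal (hG.div_const Z)
      (Filter.Eventually.of_forall fun u => div_nonneg (hG0 u) hZ.le), integral_div]
    exact ENNReal.ofReal_le_ofReal ((div_le_iff₀ hZ).2 hGd)
  have hmeas' : Measurable fun u : Fin k → ℝ => ENNReal.ofReal (noiseDensity l m (u + w) / Z) :=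
    hmeas.comp (measurable_id.add_const w)
  rw [hshift, ← lintegral_const_mul _ hmeas']
  refine le_trans ?_ (add_le_add le_rfl hGint)
  rw [← lintegral_add_left (hmeas'.const_mul _)]
  refine lintegral_mono fun u => ?_
  simp only
  rw [← ENNReal.ofReal_mul (Real.exp_pos ε).le, ← ENNReal.ofReal_add
    (mul_nonneg (Real.exp_pos ε).le (div_pos (noiseDensity_pos hl _) hZ).le)
    (div_nonneg (hG0 u) hZ.le), mul_div_assoc', ← add_div]
  exact ENNReal.ofReal_le_ofReal (div_le_div_of_nonneg_right (h u) hZ.le)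

lemma lintegral_norm_noiseMeasure_le (hl : 0 < l) (hl1 : l ≤ 1) (hm : 1 ≤ m)
    (hk : 8 * l ^ 2 * k ≤ m) :
    ∫⁻ u, ENNReal.ofReal ‖u‖ ∂noiseMeasure k l m ≤ ENNReal.ofReal 3 := by
  have hm0 : 0 < m := by linarith
  have hZ := integral_noiseDensity_pos (k := k) hl hm0.le
  have h := integral_norm_mul_noiseDensity_le hl hl1 hm hk
  rw [noiseMeasure]
  set Z := ∫ u : Fin k → ℝ, noiseDensity l m u
  rw [lintegral_withDensity_eq_lintegral_mul _
    ((continuous_noiseDensity l m).measurable.div_const Z).ennreal_ofReal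
    measurable_norm.ennreal_ofReal]
  have hmul : ∀ u : Fin k → ℝ, ((fun u : Fin k → ℝ => ENNReal.ofReal (noiseDensity l m u / Z)) *
      fun u : Fin k → ℝ => ENNReal.ofReal ‖u‖) u =
        ENNReal.ofReal (‖u‖ * noiseDensity l m u / Z) := by
    intro u
    rw [Pi.mul_apply, ← ENNReal.ofReal_mul (div_pos (noiseDensity_pos hl u) hZ).le]
    ring_nf
  rw [lintegral_congr hmul, ← ofReal_integral_eq_lintegral_ofReal
    ((integrable_norm_mul_noiseDensity hl hm0).div_const Z)
    (Filter.Eventually.of_forall fun u =>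
      div_nonneg (mul_nonneg (norm_nonneg u) (noiseDensity_pos hl u).le) hZ.le), integral_div]
  exact ENNReal.ofReal_le_ofReal ((div_le_iff₀ hZ).2 h)

/-- The mechanism that adds `R • u` to the true answers, with `u` drawn from `ν`. -/
noncomputable def additiveNoise (ν : Measure (Fin k → ℝ)) (R : ℝ) :
    Kernel (Fin k → ℝ) (Fin k → ℝ) :=
  (Kernel.id ×ₖ Kernel.const _ ν).map fun p => p.1 + R • p.2

lemma additiveNoise_apply (ν : Measure (Fin k → ℝ)) [SFinite ν] (R : ℝ) (x : Fin k → ℝ) :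
    additiveNoise ν R x = ν.map fun u => x + R • u := by
  rw [additiveNoise, Kernel.map_apply _ (by fun_prop), Kernel.prod_apply, Kernel.id_apply,
    Kernel.const_apply, Measure.dirac_prod, Measure.map_map (by fun_prop) (by fun_prop)]
  rfl

lemma isMarkovKernel_additiveNoise (ν : Measure (Fin k → ℝ)) [IsProbabilityMeasure ν] (R : ℝ) :
    IsMarkovKernel (additiveNoise ν R) := by
  unfold additiveNoise
  exact Kernel.IsMarkovKernel.map _ (by fun_prop)

lemma linftyError_le (x a : Fin k → ℝ) : linftyError x a ≤ ENNReal.ofReal ‖x - a‖ :=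
  iSup_le fun i => ENNReal.ofReal_le_ofReal (norm_le_pi_norm (x - a) i)

lemma measurable_linftyError (x : Fin k → ℝ) : Measurable (linftyError x) := by
  unfold linftyError
  fun_prop

lemma lintegral_linftyError_additiveNoise_le (ν : Measure (Fin k → ℝ)) [IsProbabilityMeasure ν]
    {R : ℝ} (hR : 0 ≤ R) (x : Fin k → ℝ) :
    ∫⁻ a, linftyError x a ∂additiveNoise ν R x
      ≤ ENNReal.ofReal R * ∫⁻ u, ENNReal.ofReal ‖u‖ ∂ν := by
  rw [additiveNoise_apply, lintegral_map (measurable_linftyError x) (by fun_prop),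
    ← lintegral_const_mul _ measurable_norm.ennreal_ofReal]
  refine lintegral_mono fun u => (linftyError_le _ _).trans_eq ?_
  rw [sub_add_cancel_left, norm_neg, norm_smul, Real.norm_of_nonneg hR, ENNReal.ofReal_mul hR]

/-- Answers at sup distance at most `1` are, on the scale of the noise, a shift of norm at most
`1 / R`. -/
lemma additiveNoise_le {ν : Measure (Fin k → ℝ)} [IsProbabilityMeasure ν] {ε δ R : ℝ} (hR : 0 < R)
    (hν : ∀ w : Fin k → ℝ, ‖w‖ ≤ 1 / R → ∀ S, MeasurableSet S →
      ν S ≤ ENNReal.ofReal (Real.exp ε) * ν ((fun u => u - w) ⁻¹' S) + ENNReal.ofReal δ)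
    {x y : Fin k → ℝ} (hxy : ‖x - y‖ ≤ 1) {S : Set (Fin k → ℝ)} (hS : MeasurableSet S) :
    additiveNoise ν R x S
      ≤ ENNReal.ofReal (Real.exp ε) * additiveNoise ν R y S + ENNReal.ofReal δ := by
  rw [additiveNoise_apply, additiveNoise_apply, Measure.map_apply (by fun_prop) hS,
    Measure.map_apply (by fun_prop) hS]
  have hw : ‖R⁻¹ • (x - y)‖ ≤ 1 / R := by
    rw [norm_smul, norm_inv, Real.norm_of_nonneg hR.le, inv_mul_eq_div]
    gcongr
  have h := hν _ hw ((fun u => x + R • u) ⁻¹' S) ((by fun_prop : Measurable fun u => x + R • u) hS)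
  have hpre : (fun u => u - R⁻¹ • (x - y)) ⁻¹' ((fun u => x + R • u) ⁻¹' S)
      = (fun u => y + R • u) ⁻¹' S := by
    ext u
    change x + R • (u - R⁻¹ • (x - y)) ∈ S ↔ y + R • u ∈ S
    rw [smul_sub, smul_inv_smul₀ hR.ne', show x + (R • u - (x - y)) = y + R • u by abel]
  rwa [hpre] at h

end NoiseMeasure

/-! ### The choice of parameters -/

section Parameters

variable {k : ℕ} {ε δ : ℝ}

/-- The tail scale of the profile, for `L = log (1 / δ)`. For `k > 0` and `L > 0` it equals
`min 1 √(L / k)`. -/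
noncomputable def tailScale (k : ℕ) (L : ℝ) : ℝ := min 1 (L / √(k * L))

lemma half_le_log_one_div (hd : 0 < δ) (hd2 : δ ≤ 1 / 2) : 1 / 2 ≤ Real.log (1 / δ) := by
  have h1 : Real.log 2 ≤ Real.log (1 / δ) := by
    refine Real.log_le_log two_pos ?_
    rw [le_div_iff₀ hd]
    linarith
  linarith [Real.log_two_gt_d9]

/-- Privacy of the noise distribution under shifts of norm at most `ε / (960 * √(k log (1/δ)))`. -/
lemma noiseMeasure_tailScale_le (hk : 0 < k) (he : 0 < ε) (he1 : ε ≤ 1) (hd : 0 < δ)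
    (hd2 : δ ≤ 1 / 2) {w : Fin k → ℝ}
    (hw : 960 * √(k * Real.log (1 / δ)) * ‖w‖ ≤ ε) {S : Set (Fin k → ℝ)} (hS : MeasurableSet S) :
    noiseMeasure k (tailScale k (Real.log (1 / δ))) (8 * √(k * Real.log (1 / δ))) S
      ≤ ENNReal.ofReal (Real.exp ε) *
        noiseMeasure k (tailScale k (Real.log (1 / δ))) (8 * √(k * Real.log (1 / δ)))
          ((fun u => u - w) ⁻¹' S) + ENNReal.ofReal δ := by
  have hL := half_le_log_one_div hd hd2
  have hexp : Real.exp (-Real.log (1 / δ)) = δ := by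
    rw [Real.exp_neg, Real.exp_log (by positivity), one_div, inv_inv]
  set L := Real.log (1 / δ)
  have hk1 : (1 : ℝ) ≤ k := by exact_mod_cast hk
  have hs2 : √(k * L) ^ 2 = k * L := Real.sq_sqrt (by positivity)
  have hs : 0 < √(k * L) := Real.sqrt_pos.2 (by positivity)
  have hw0 := norm_nonneg w
  unfold tailScale
  set s := √(k * L)
  rcases le_total L k with hLk | hkL
  · have hLs : L ≤ s := Real.le_sqrt_of_sq_le (by nlinarith)
    have hl1 : L / s ≤ 1 := (div_le_one hs).2 hLs
    have hl : 0 < L / s := by positivity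
    rw [min_eq_right hl1]
    -- The Chernoff exponent `20 * L / ε` is the largest for which the exponential moments are
    -- controlled: shifts have norm at most `ε / (960 * s)` and `20 / 960 = 1 / 48`.
    have ha : 1 ≤ 20 * L / ε := by
      rw [le_div_iff₀ he]
      linarith
    have haw : 20 * L / ε * ‖w‖ ≤ L / s / 48 := by
      rw [div_mul_eq_mul_div, div_div, div_le_div_iff₀ he (by positivity)]
      nlinarith
    refine noiseMeasure_le_of_forall_le hl (by positivity) (integrable_lossExcess hl ha haw)
      (lossExcess_nonneg (ε := ε) hl w) ?_
      (noiseDensity_le_add_lossExcess hl (by positivity) (by linarith) (by linarith)) hS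
    refine (integral_lossExcess_le hl hl1 ha haw).trans ?_
    have hexponent : 9 * (L / s) ^ 2 * k - 20 * L / ε * (ε / 2) = -L := by
      rw [div_pow, hs2]
      field_simp
      ring
    rw [hexponent, hexp]
    exact mul_le_mul_of_nonneg_left (coreMass_pow_le hl (by positivity)) hd.le
  · have hsL : s ≤ L := Real.sqrt_le_iff.2 ⟨by linarith, by nlinarith⟩
    have hks : k ≤ s := Real.le_sqrt_of_sq_le (by nlinarith)
    rw [min_eq_left ((one_le_div hs).2 hsL)]
    -- Here `k ≤ s`, so the loss of the product part is at most `6 * k * ‖w‖ ≤ ε / 2` everywhere.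
    refine noiseMeasure_le_of_forall_le (G := fun _ => 0) one_pos (by positivity)
      (integrable_zero _ _ _) (fun _ => le_rfl) ?_ (fun u => ?_) hS
    · rw [integral_zero]
      exact mul_nonneg hd.le (integral_noiseDensity_pos one_pos (by positivity)).le
    · rw [add_zero]
      refine noiseDensity_le_of_sum_le one_pos (by positivity) (by linarith)
        ((sum_logRatio_le one_pos (by nlinarith) u).trans ?_)
      nlinarith

end Parameters

end DP

/-- A randomized algorithm answering `k` queries is a Markov kernel `M` that turns the tuple of
true answers `(q 0 X, …, q (k - 1) X)` into a random tuple of reported answers. -/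
theorem theorem1 :
    ∃ C : ℝ, 0 < C ∧
      ∀ (k : ℕ) (ε δ : ℝ), 0 < ε → ε ≤ 1 → 0 < δ → δ ≤ 1 / 2 →
        ∃ M : Kernel (Fin k → ℝ) (Fin k → ℝ), IsMarkovKernel M ∧
          ∀ (𝒳 : Type*) (nbr : 𝒳 → 𝒳 → Prop) (q : Fin k → 𝒳 → ℝ),
            (∀ i, DP.sensitivity nbr (q i) ≤ 1) →
              DP.IsDifferentiallyPrivate nbr ε δ (fun X => M (fun i => q i X)) ∧
              ∀ X : 𝒳,
                ∫⁻ a, DP.linftyError (fun i => q i X) a ∂(M (fun i => q i X)) ≤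
                  ENNReal.ofReal (C * DP.errorBound k ε δ) := by
  refine ⟨3 * 960, by norm_num, fun k ε δ hε hε1 hδ hδ2 => ?_⟩
  -- Without queries the noise scale is `0` and `tailScale` would be a junk value; there the exact
  -- answers, of which there are none, are private.
  rcases Nat.eq_zero_or_pos k with rfl | hk
  · refine ⟨Kernel.id, inferInstance, fun 𝒳 nbr q _ => ⟨fun X X' _ S _ => ?_, fun X => ?_⟩⟩
    · simp only
      rw [Subsingleton.elim (fun i => q i X) fun i => q i X']
      refine le_trans ?_ le_self_add
      exact le_mul_of_one_le_left' (by simpa using hε.le)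
    · simp [DP.linftyError]
  · have hL := DP.half_le_log_one_div hδ hδ2
    set s := √(k * Real.log (1 / δ)) with hs_def
    set l := DP.tailScale k (Real.log (1 / δ)) with hl_def
    have hk1 : (1 : ℝ) ≤ k := by exact_mod_cast hk
    have hs2 : s ^ 2 = k * Real.log (1 / δ) := Real.sq_sqrt (by positivity)
    have hs : 1 / 2 ≤ s := Real.le_sqrt_of_sq_le (by nlinarith)
    have hs0 : 0 < s := by linarith
    have hl : 0 < l := lt_min one_pos (by positivity)
    have hl1 : l ≤ 1 := min_le_left _ _
    have hlk : l * k ≤ s := by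
      have h1 : l ≤ Real.log (1 / δ) / s := min_le_right _ _
      rw [le_div_iff₀ hs0] at h1
      nlinarith
    have := DP.isProbabilityMeasure_noiseMeasure (k := k) (m := 8 * s) hl (by positivity)
    have hR : 0 < 960 * s / ε := by positivity
    refine ⟨DP.additiveNoise (DP.noiseMeasure k l (8 * s)) (960 * s / ε),
      DP.isMarkovKernel_additiveNoise _ _, fun 𝒳 nbr q hq => ⟨fun X X' hX S hS => ?_, fun X => ?_⟩⟩
    · refine DP.additiveNoise_le hR (fun w hw T hT => ?_) ?_ hS
      · refine DP.noiseMeasure_tailScale_le hk hε hε1 hδ hδ2 ?_ hT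
        rw [one_div_div, le_div_iff₀ (by positivity)] at hw
        linarith
      · refine (pi_norm_le_iff_of_nonneg zero_le_one).2 fun i => ?_
        have h := (le_iSup₂_of_le X X' (le_iSup_of_le hX le_rfl)).trans (hq i)
        exact ENNReal.ofReal_le_one.1 h
    · refine (DP.lintegral_linftyError_additiveNoise_le _ hR.le _).trans ?_
      calc _ ≤ ENNReal.ofReal (960 * s / ε) * ENNReal.ofReal 3 := by
            gcongr
            refine DP.lintegral_norm_noiseMeasure_le hl hl1 (by linarith) ?_
            nlinarith
        _ = _ := by
            rw [← ENNReal.ofReal_mul hR.le, DP.errorBound, ← hs_def]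
            ring_nf
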